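/- Let $(Z_t)_{t\ge 1}$ be a stationary process with values in a measurable space $\mathcal Z$, with marginal law $\mu$, and let $\mathcal F_s=\sigma(Z_1,\dots,Z_s)$ (trivial for $s\le 0$). Let $\ell:\mathcal W\times\mathcal Z\to[0,1]$ be a jointly measurable loss on a measurable hypothesis space $\mathcal W$; put $\mathcal L(w)=\mathbb E_{Z'\sim\mu}[\ell(w,Z')]$ and $c_t(w)=\ell(w,Z_t)-\mathcal L(w)$. Assume that the process is geometrically mixing with constants $\tau,C>0$: for every $w\in\mathcal W$ and all integers $t,d\ge 1$, $$\mathbb E\big[\mathcal L(w)-\ell(w,Z_t)\,\big|\,\mathcal F_{t-d}\big]\le C e^{-d/\tau}\quad\text{almost surely.}$$ Let $\|\cdot\|$ be a norm on the space $\mathcal Q$ of finite signed measures on $\mathcal W$, with dual norm $\|f\|_*=\sup\{\langle Q,f\rangle: Q\in\mathcal Q,\ \|Q\|\le 1\}$, and let $\Delta_{\mathcal W}$ be the set of probability measures on $\mathcal W$. Let $\alpha>0$ and let $h:\Delta_{\mathcal W}\to(-\infty,+\infty]$ be proper, lower semi-continuous and $\alpha$-strongly convex with respect to $\|\cdot\|$,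 i.e. $$h(\lambda P+(1-\lambda)P')\le\lambda h(P)+(1-\lambda)h(P')-\tfrac{\alpha\lambda(1-\lambda)}{2}\|P-P'\|^2\qquad(P,P'\in\Delta_{\mathcal W},\ \lambda\in[0,1]).$$ Assume that $\{P\in\Delta_{\mathcal W}:h(P)<\infty\}$ is separable for $\|\cdot\|$ (this holds in particular if $\Delta_{\mathcal W}$ is compact for $\|\cdot\|$). Let $P_1\in\Delta_{\mathcal W}$ be the initial prediction of follow-the-regularized-leader with regularizer $h$, i.e. a minimizer of $h$ over $\Delta_{\mathcal W}$. Assume that there is $B>0$ such that $\|c_t\|_*\le B$ almost surely for all $t\ge 1$. For a sample size $n\ge 1$ let $S_n=(Z_1,\dots,Z_n)$. For a randomized learning algorithm $\mathcal A: S_n\mapsto P_{W_n|S_n}$ (a Markov kernel from $\mathcal Z^n$ to $\mathcal W$) let $$\mathrm{Gen}(\mathcal A,S_n)=\mathbb E_{W_n\sim P_{W_n|S_n}}\Big[\mathcal L(W_n)-\frac1n\sum_{i=1}^n\ell(W_n,Z_i)\Big].$$ Then, for every $\eta>0$, $n\ge 1$ and $\delta>0$, with probability at least $1-\delta$ on the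 draw of $S_n$, simultaneously for all learning algorithms $\mathcal A$, $$\mathrm{Gen}(\mathcal A,S_n)\le\frac{\big(h(P_{W_n|S_n})-h(P_1)\big)(\tau\log n+1)}{\eta n}+\frac{\eta B^2}{2\alpha}+\frac Cn+\sqrt{\frac{2(\tau\log n+1)\log(1/\delta)}{n}}.$$ (The exceptional event is contained in a measurable event of probability at most $\delta$. For $\delta>1$ the claim is void, and the square root is then read as $0$.) -/

import Mathlib

open MeasureTheory

noncomputable section

namespace OnlineToPAC

variable {Ω 𝒵 W : Type*} [MeasurableSpace Ω] [MeasurableSpace 𝒵] [MeasurableSpace W]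

/-! ### The data process.  It is `Z 1, Z 2, …`; the variable `Z 0` is never used. -/

/-- `pastSigma Z s` is the σ-algebra `ℱ_s` generated by `Z 1, …, Z s`.  It is trivial for
`s = 0`, so that with truncated subtraction `ℱ_{t-d}` is trivial whenever `t ≤ d`. -/
abbrev pastSigma (Z : ℕ → Ω → 𝒵) (s : ℕ) : MeasurableSpace Ω :=
  ⨆ i ∈ Finset.Icc 1 s, MeasurableSpace.comap (Z i) inferInstance

/-- `(Z t)_{t ≥ 1}` is a stationary process: the law of a finite block of consecutive variables
is not changed by a time shift. -/
structure IsStationaryProcess (prob : Measure Ω) (Z : ℕ → Ω → 𝒵) : Prop where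
  measurable : ∀ t, 1 ≤ t → Measurable (Z t)
  map_block_shift : ∀ t i j : ℕ, 1 ≤ t →
    prob.map (fun ω (k : Fin (i + 1)) => Z (t + k) ω)
      = prob.map (fun ω (k : Fin (i + 1)) => Z (t + j + k) ω)

/-- The common law `μ` of the `Z t`. -/
def marginal (prob : Measure Ω) (Z : ℕ → Ω → 𝒵) : Measure 𝒵 := prob.map (Z 1)

/-- The sample `S_n = (Z 1, …, Z n)`. -/
def sample (Z : ℕ → Ω → 𝒵) (n : ℕ) (ω : Ω) : Fin n → 𝒵 := fun i => Z (i + 1) ω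

/-! ### Losses and generalization error -/

/-- The test error `L(w) = 𝔼_{Z' ∼ μ} ℓ(w, Z')`. -/
def testError (ℓ : W → 𝒵 → ℝ) (μ : Measure 𝒵) (w : W) : ℝ := ∫ z, ℓ w z ∂μ

/-- The training error of `w` on the sample `s`. -/
def trainError {n : ℕ} (ℓ : W → 𝒵 → ℝ) (w : W) (s : Fin n → 𝒵) : ℝ :=
  (1 / (n : ℝ)) * ∑ i, ℓ w (s i)

/-- The generalization error on the sample `s` of a randomized learning algorithm, that is, of a
Markov kernel `𝒜` sending a sample to the law of the returned hypothesis. -/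
def gen {n : ℕ} (ℓ : W → 𝒵 → ℝ) (μ : Measure 𝒵)
    (𝒜 : ProbabilityTheory.Kernel (Fin n → 𝒵) W) (s : Fin n → 𝒵) : ℝ :=
  ∫ w, (testError ℓ μ w - trainError ℓ w s) ∂(𝒜 s)

/-- The law `P_{W_n | S_n = s}` of the hypothesis that `𝒜` returns on the sample `s`. -/
def output {n : ℕ} (𝒜 : ProbabilityTheory.Kernel (Fin n → 𝒵) W)
    [ProbabilityTheory.IsMarkovKernel 𝒜] (s : Fin n → 𝒵) : ProbabilityMeasure W :=
  ⟨𝒜 s, inferInstance⟩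

/-- The cost function `w ↦ ℓ(w, z) - L(w)` of the generalization game when `z` is observed. -/
def cost (ℓ : W → 𝒵 → ℝ) (μ : Measure 𝒵) (z : 𝒵) (w : W) : ℝ := ℓ w z - testError ℓ μ w

/-! ### Mixing -/

/-- The loss mixes at rate `φ` along the process: for each hypothesis `w`, time `t` and lag `d`,
`𝔼[L(w) - ℓ(w, Z_t) | ℱ_{t-d}] ≤ φ_d` almost surely. -/
structure MixesAtRate (prob : Measure Ω) (Z : ℕ → Ω → 𝒵) (ℓ : W → 𝒵 → ℝ) (φ : ℕ → ℝ) :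
    Prop where
  antitone : ∀ d e : ℕ, 1 ≤ d → d ≤ e → φ e ≤ φ d
  nonneg : ∀ d : ℕ, 1 ≤ d → 0 ≤ φ d
  condExp_le : ∀ (w : W) (t d : ℕ), 1 ≤ t → 1 ≤ d →
    ∀ᵐ ω ∂prob,
      (prob[fun ω' => testError ℓ (marginal prob Z) w - ℓ w (Z t ω') | pastSigma Z (t - d)]) ω
        ≤ φ d

/-- `(Z t)_{t ≥ 1}` is a geometrically mixing (stationary) process with constants `τ, C > 0`. -/
structure IsGeometricallyMixing (prob : Measure Ω) (Z : ℕ → Ω → 𝒵) (ℓ : W → 𝒵 → ℝ)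
    (τ C : ℝ) : Prop where
  stationary : IsStationaryProcess prob Z
  tau_pos : 0 < τ
  C_pos : 0 < C
  mixes : MixesAtRate prob Z ℓ (fun d => C * Real.exp (-(d : ℝ) / τ))

/-! ### Norms on signed measures and regularizers -/

/-- A real-valued seminorm on the space of finite signed measures is a norm if it is definite. -/
def IsNorm (N : Seminorm ℝ (SignedMeasure W)) : Prop := ∀ Q, N Q = 0 → Q = 0

/-- The dual norm `sup {⟨Q, f⟩ : ‖Q‖ ≤ 1}`, in the extended reals. -/
def dualNorm (N : Seminorm ℝ (SignedMeasure W)) (f : W → ℝ) : EReal :=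
  ⨆ (Q : SignedMeasure W) (_ : N Q ≤ 1), ((∫ᵛ w, f w ∂<•Q : ℝ) : EReal)

/-- `‖P - P'‖` for two probability measures. -/
def normDist (N : Seminorm ℝ (SignedMeasure W)) (P P' : ProbabilityMeasure W) : ℝ :=
  N ((P : Measure W).toSignedMeasure - (P' : Measure W).toSignedMeasure)

/-- The convex combination `r P + (1 - r) P'`. -/
def mix (r : ℝ) (hr : r ∈ Set.Icc (0 : ℝ) 1) (P P' : ProbabilityMeasure W) :
    ProbabilityMeasure W :=
  ⟨ENNReal.ofReal r • (P : Measure W) + ENNReal.ofReal (1 - r) • (P' : Measure W), ⟨by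
    simp only [Measure.add_apply, Measure.smul_apply, measure_univ, smul_eq_mul, mul_one]
    rw [← ENNReal.ofReal_add hr.1 (sub_nonneg.2 hr.2)]
    simp⟩⟩

/-- A regularizer: a proper, lower semi-continuous, `α`-strongly convex function on probability
measures with values in `(-∞, +∞]`, with respect to the norm `N`. -/
structure IsRegularizer (N : Seminorm ℝ (SignedMeasure W)) (α : ℝ)
    (h : ProbabilityMeasure W → EReal) : Prop where
  ne_bot : ∀ P, h P ≠ ⊥
  proper : ∃ P, h P ≠ ⊤
  lsc : ∀ (P : ProbabilityMeasure W) (a : EReal), a < h P →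
    ∃ ε : ℝ, 0 < ε ∧ ∀ P', normDist N P' P < ε → a < h P'
  strongConvex : ∀ (P P' : ProbabilityMeasure W) (r : ℝ) (hr : r ∈ Set.Icc (0 : ℝ) 1),
    h (mix r hr P P') ≤ (r : EReal) * h P + ((1 - r : ℝ) : EReal) * h P'
      - ((α * r * (1 - r) / 2 * normDist N P P' ^ 2 : ℝ) : EReal)

/-- The effective domain `{P : h P < +∞}` is separable for the norm `N`.  This holds for instance
if the set of all probability measures is compact for `N`. -/
def HasSeparableDomain (N : Seminorm ℝ (SignedMeasure W)) (h : ProbabilityMeasure W → EReal) :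
    Prop :=
  ∃ D : Set (ProbabilityMeasure W), D.Countable ∧
    ∀ P, h P < ⊤ → ∀ ε : ℝ, 0 < ε → ∃ P' ∈ D, normDist N P P' < ε

end OnlineToPAC

end

noncomputable section

namespace OnlineToPAC

/-! ### Concentration along a delayed filtration -/

/-! Let an online learner play a measure `p j` in round `j` and pay its expected cost on `Z (j +
1)`. For every measure `Q`, minus the total cost of `Q` equals the regret against `Q` minus the
total cost of the learner. At the output of an algorithm the left side is `n` times the
generalization error. The regret bound is deterministic and holds for all `Q` at once, and the
learner's own cost does not involve `Q`, so one concentration event serves all algorithms.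

Dependence is handled by a delay `d`: a separate copy of follow-the-regularized-leader runs on each
residue class modulo `d`, so `p j` uses only data at least `d` steps old. Having `d` copies
multiplies the regularizer term by `d` (`IsRegularizer.regret`). By mixing, minus the cost of `p j`
has delayed conditional mean at most `φ d` (`integral_mul_expCost_select_le`), and a blockwise
Hoeffding argument bounds the sum (`measure_sum_ge_le`). A delay of about `τ log n` makes `φ d` at
most `C / n`.

Exact minimizers may fail to exist or to depend measurably on the data. The learner therefore picks,
measurably, an `s ^ 2`-minimizer from a countable family that approximates both points and values of
`h`; `s` tends to `0` at the end. -/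

lemma sinh_le_mul_cosh {x : ℝ} (hx : 0 ≤ x) : Real.sinh x ≤ x * Real.cosh x := by
  have hmono : MonotoneOn (fun y : ℝ => y * Real.cosh y - Real.sinh y) (Set.Ici 0) := by
    refine monotoneOn_of_deriv_nonneg (convex_Ici 0) (by fun_prop) (by fun_prop) ?_
    intro y hy
    rw [interior_Ici] at hy
    have : HasDerivAt (fun y : ℝ => y * Real.cosh y - Real.sinh y)
        (1 * Real.cosh y + y * Real.sinh y - Real.cosh y) y :=
      ((hasDerivAt_id y).mul (Real.hasDerivAt_cosh y)).sub (Real.hasDerivAt_sinh y)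
    rw [this.deriv]
    have := mul_nonneg (le_of_lt hy) (Real.sinh_nonneg_iff.2 (le_of_lt hy))
    linarith
  simpa using hmono Set.self_mem_Ici hx hx

/-- One step of the exponential moment: convexity bounds `exp (x * X)` by `cosh x + X * sinh x` for
`|X| ≤ 1`. A drift `φ` costs at most `xφ cosh x`, so `cosh x` factors out and the drift becomes the
factor `exp (x * φ)` that centring cancels. -/
lemma cosh_add_mul_sinh_le {x φ : ℝ} (hx : 0 ≤ x) (hφ : 0 ≤ φ) :
    Real.cosh x + φ * Real.sinh x ≤ Real.exp (x * φ) * Real.exp (x ^ 2 / 2) := by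
  have h1 := mul_le_mul_of_nonneg_left (sinh_le_mul_cosh hx) hφ
  have h2 : x * φ + 1 ≤ Real.exp (x * φ) := Real.add_one_le_exp _
  calc Real.cosh x + φ * Real.sinh x ≤ (x * φ + 1) * Real.cosh x := by linarith
    _ ≤ Real.exp (x * φ) * Real.exp (x ^ 2 / 2) :=
      mul_le_mul h2 (Real.cosh_le_exp_half_sq x) (Real.cosh_pos x).le (Real.exp_pos _).le

section Concentration

variable {Ω : Type*} {mΩ : MeasurableSpace Ω} {prob : Measure Ω} [IsProbabilityMeasure prob]

lemma integrable_of_measurable_of_abs_le {f : Ω → ℝ} (hf : Measurable f) {b : ℝ}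
    (hb : ∀ ω, |f ω| ≤ b) : Integrable f prob :=
  Integrable.of_bound hf.aestronglyMeasurable b (Filter.Eventually.of_forall hb)

/-- The centred sum over the indices `j < m` with `j ≡ k (mod d)`. -/
def classSum (X : ℕ → Ω → ℝ) (φ : ℝ) (d k m : ℕ) (ω : Ω) : ℝ :=
  ∑ j ∈ (Finset.range m).filter (fun j => j % d = k), (X j ω - φ)

lemma classSum_succ_of_eq (X : ℕ → Ω → ℝ) (φ : ℝ) {d k m : ℕ} (hm : m % d = k) (ω : Ω) :
    classSum X φ d k (m + 1) ω = classSum X φ d k m ω + (X m ω - φ) := by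
  rw [classSum, Finset.range_add_one, Finset.filter_insert, if_pos hm,
    Finset.sum_insert (by simp), add_comm, classSum]

lemma classSum_succ_of_ne (X : ℕ → Ω → ℝ) (φ : ℝ) {d k m : ℕ} (hm : m % d ≠ k) (ω : Ω) :
    classSum X φ d k (m + 1) ω = classSum X φ d k m ω := by
  rw [classSum, Finset.range_add_one, Finset.filter_insert, if_neg hm, classSum]

lemma abs_classSum_le {X : ℕ → Ω → ℝ} {φ : ℝ} (hφ : 0 ≤ φ) (hX : ∀ j ω, |X j ω| ≤ 1)
    (d k m : ℕ) (ω : Ω) : |classSum X φ d k m ω| ≤ m * (1 + φ) := by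
  refine (Finset.abs_sum_le_sum_abs _ _).trans ?_
  refine (Finset.sum_le_card_nsmul _ _ (1 + φ) fun j _ => ?_).trans ?_
  · exact (abs_sub _ _).trans (add_le_add (hX j ω) (abs_of_nonneg hφ).le)
  · rw [nsmul_eq_mul]
    refine mul_le_mul_of_nonneg_right ?_ (by positivity)
    exact_mod_cast (Finset.card_filter_le _ _).trans (Finset.card_range m).le

lemma add_le_of_mod_eq {d j k m : ℕ} (hjm : j < m) (hj : j % d = k) (hm : m % d = k) :
    j + d ≤ m := by
  have hdvd : d ∣ m - j := (Nat.modEq_iff_dvd' hjm.le).1 (hj.trans hm.symm)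
  have := Nat.le_of_dvd (by omega) hdvd
  omega

/-- Earlier indices of the class of `m` are at least `d` smaller, so their terms are already known
in the delayed past of `X m`. With truncated subtraction this includes `m < d`, where the sum is
empty. -/
lemma measurable_classSum {ℱ : ℕ → MeasurableSpace Ω} (hℱ : Monotone ℱ) {X : ℕ → Ω → ℝ}
    (hXm : ∀ j, Measurable[ℱ (j + 1)] (X j)) (φ : ℝ) {d k m : ℕ} (hm : m % d = k) :
    Measurable[ℱ (m + 1 - d)] (classSum X φ d k m) := by
  unfold classSum
  refine Finset.measurable_sum _ fun j hj => ?_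
  rw [Finset.mem_filter, Finset.mem_range] at hj
  have := add_le_of_mod_eq hj.1 hj.2 hm
  exact ((hXm j).mono (hℱ (by omega)) le_rfl).sub_const φ

/-- The usual supermartingale induction within one class. `hXφ` is the integrated form of `𝔼[X j | ℱ
(j + 1 - d)] ≤ φ`, used with the exponential of the previous class sum as test function `Y`. -/
lemma integral_exp_classSum_le {ℱ : ℕ → MeasurableSpace Ω} (hℱ : Monotone ℱ)
    (hℱm : ∀ j, ℱ j ≤ mΩ) {X : ℕ → Ω → ℝ} (hX : ∀ j ω, |X j ω| ≤ 1)
    (hXm : ∀ j, Measurable[ℱ (j + 1)] (X j)) {φ : ℝ} (hφ : 0 ≤ φ) {d : ℕ}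
    (hXφ : ∀ (j : ℕ) (Y : Ω → ℝ) (b : ℝ), Measurable[ℱ (j + 1 - d)] Y → (∀ ω, 0 ≤ Y ω) →
      (∀ ω, Y ω ≤ b) → ∫ ω, Y ω * X j ω ∂prob ≤ φ * ∫ ω, Y ω ∂prob)
    (k m : ℕ) {x : ℝ} (hx : 0 ≤ x) :
    ∫ ω, Real.exp (x * classSum X φ d k m ω) ∂prob
      ≤ Real.exp (x ^ 2 / 2 * ((Finset.range m).filter (fun j => j % d = k)).card) := by
  induction m with
  | zero => simp [classSum]
  | succ m ih =>
    by_cases hm : m % d = k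
    swap
    · simp_rw [classSum_succ_of_ne X φ hm]
      rwa [Finset.range_add_one, Finset.filter_insert, if_neg hm]
    set Y : Ω → ℝ := fun ω => Real.exp (x * classSum X φ d k m ω) with hYdef
    have hYm : Measurable[ℱ (m + 1 - d)] Y :=
      Real.measurable_exp.comp ((measurable_classSum hℱ hXm φ hm).const_mul x)
    have hYm' : Measurable Y := hYm.mono (hℱm _) le_rfl
    have hXm' : Measurable (X m) := (hXm m).mono (hℱm _) le_rfl
    have hY0 : ∀ ω, 0 ≤ Y ω := fun ω => (Real.exp_pos _).le
    have hYb : ∀ ω, Y ω ≤ Real.exp (x * (m * (1 + φ))) := fun ω =>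
      Real.exp_le_exp.2 (mul_le_mul_of_nonneg_left
        ((le_abs_self _).trans (abs_classSum_le hφ hX d k m ω)) hx)
    have hYi : Integrable Y prob := integrable_of_measurable_of_abs_le hYm' fun ω => by
      rw [abs_of_nonneg (hY0 ω)]; exact hYb ω
    have hYXi : Integrable (fun ω => Y ω * X m ω) prob :=
      integrable_of_measurable_of_abs_le (hYm'.mul hXm') (b := Real.exp (x * (m * (1 + φ))))
        fun ω => by
          rw [abs_mul, abs_of_nonneg (hY0 ω)]
          calc Y ω * |X m ω| ≤ Y ω * 1 := mul_le_mul_of_nonneg_left (hX m ω) (hY0 ω)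
            _ ≤ _ := by rw [mul_one]; exact hYb ω
    have hcard : (((Finset.range (m + 1)).filter (fun j => j % d = k)).card : ℝ)
        = ((Finset.range m).filter (fun j => j % d = k)).card + 1 := by
      rw [Finset.range_add_one, Finset.filter_insert, if_pos hm,
        Finset.card_insert_of_notMem (by simp)]
      push_cast; rfl
    have hpt : ∀ ω, Real.exp (x * classSum X φ d k (m + 1) ω)
        ≤ Real.exp (-(x * φ)) * (Real.cosh x * Y ω + Real.sinh x * (Y ω * X m ω)) := fun ω => by
      have h1 := Real.exp_mul_le_cosh_add_mul_sinh (hX m ω) x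
      rw [classSum_succ_of_eq X φ hm,
        show x * (classSum X φ d k m ω + (X m ω - φ))
          = -(x * φ) + (x * classSum X φ d k m ω + X m ω * x) by ring, Real.exp_add, Real.exp_add]
      refine mul_le_mul_of_nonneg_left ?_ (Real.exp_pos _).le
      calc _ ≤ Y ω * (Real.cosh x + X m ω * Real.sinh x) :=
            mul_le_mul_of_nonneg_left h1 (hY0 ω)
        _ = _ := by ring
    have hint : Integrable
        (fun ω => Real.cosh x * Y ω + Real.sinh x * (Y ω * X m ω)) prob :=
      (hYi.const_mul _).add (hYXi.const_mul _)
    calc ∫ ω, Real.exp (x * classSum X φ d k (m + 1) ω) ∂prob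
        ≤ ∫ ω, Real.exp (-(x * φ)) * (Real.cosh x * Y ω + Real.sinh x * (Y ω * X m ω)) ∂prob :=
          integral_mono_of_nonneg (Filter.Eventually.of_forall fun ω => (Real.exp_pos _).le)
            (hint.const_mul _) (Filter.Eventually.of_forall hpt)
      _ = Real.exp (-(x * φ)) * (Real.cosh x * ∫ ω, Y ω ∂prob
            + Real.sinh x * ∫ ω, Y ω * X m ω ∂prob) := by
          rw [integral_const_mul, integral_add (hYi.const_mul _) (hYXi.const_mul _),
            integral_const_mul, integral_const_mul]
      _ ≤ Real.exp (-(x * φ)) * (Real.cosh x * ∫ ω, Y ω ∂prob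
            + Real.sinh x * (φ * ∫ ω, Y ω ∂prob)) := by
          refine mul_le_mul_of_nonneg_left (add_le_add_right ?_ _) (Real.exp_pos _).le
          exact mul_le_mul_of_nonneg_left (hXφ m Y _ hYm hY0 hYb) (Real.sinh_nonneg_iff.2 hx)
      _ = Real.exp (-(x * φ)) * (Real.cosh x + φ * Real.sinh x) * ∫ ω, Y ω ∂prob := by ring
      _ ≤ Real.exp (-(x * φ)) * (Real.exp (x * φ) * Real.exp (x ^ 2 / 2)) *
            Real.exp (x ^ 2 / 2 * ((Finset.range m).filter (fun j => j % d = k)).card) := by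
          refine mul_le_mul ?_ ih (integral_nonneg hY0) (by positivity)
          exact mul_le_mul_of_nonneg_left (cosh_add_mul_sinh_le hx hφ) (Real.exp_pos _).le
      _ = _ := by
          rw [hcard, ← Real.exp_add, ← Real.exp_add, ← Real.exp_add]
          congr 1; ring

lemma sum_classSum (X : ℕ → Ω → ℝ) (φ : ℝ) {d : ℕ} (hd : 1 ≤ d) (n : ℕ) (ω : Ω) :
    ∑ k ∈ Finset.range d, classSum X φ d k n ω = ∑ j ∈ Finset.range n, (X j ω - φ) :=
  Finset.sum_fiberwise_of_maps_to
    (fun j _ => Finset.mem_range.2 (Nat.mod_lt j (by omega))) _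

lemma sum_card_class {d : ℕ} (hd : 1 ≤ d) (n : ℕ) :
    ∑ k ∈ Finset.range d, (((Finset.range n).filter (fun j => j % d = k)).card : ℝ) = n := by
  have := Finset.card_eq_sum_card_fiberwise (s := Finset.range n) (t := Finset.range d)
    (f := fun j => j % d) (fun j _ => by simpa using Nat.mod_lt j (by omega))
  rw [Finset.card_range] at this
  exact_mod_cast this.symm

/-- The classes depend on each other, so they are combined by convexity of `exp` rather than by a
product. Weights proportional to the square roots of the class sizes equalize the exponents, and
Cauchy–Schwarz then gives `d * n` even when `d` does not divide `n`. -/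
lemma integral_exp_sum_le {ℱ : ℕ → MeasurableSpace Ω} (hℱ : Monotone ℱ)
    (hℱm : ∀ j, ℱ j ≤ mΩ) {X : ℕ → Ω → ℝ} (hX : ∀ j ω, |X j ω| ≤ 1)
    (hXm : ∀ j, Measurable[ℱ (j + 1)] (X j)) {φ : ℝ} (hφ : 0 ≤ φ) {d : ℕ} (hd : 1 ≤ d)
    (hXφ : ∀ (j : ℕ) (Y : Ω → ℝ) (b : ℝ), Measurable[ℱ (j + 1 - d)] Y → (∀ ω, 0 ≤ Y ω) →
      (∀ ω, Y ω ≤ b) → ∫ ω, Y ω * X j ω ∂prob ≤ φ * ∫ ω, Y ω ∂prob)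
    {n : ℕ} (hn : 1 ≤ n) {x : ℝ} (hx : 0 ≤ x) :
    ∫ ω, Real.exp (x * ∑ j ∈ Finset.range n, (X j ω - φ)) ∂prob
      ≤ Real.exp (x ^ 2 / 2 * (d * n)) := by
  set c : ℕ → ℝ := fun k => ((Finset.range n).filter (fun j => j % d = k)).card with hc
  have hc0 : ∀ k, 0 ≤ c k := fun k => Nat.cast_nonneg _
  set R : ℝ := ∑ k ∈ Finset.range d, Real.sqrt (c k) with hR
  have hcn : ∑ k ∈ Finset.range d, c k = n := sum_card_class hd n
  have hRsq : R ^ 2 ≤ d * n := by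
    have h1 := sq_sum_le_card_mul_sum_sq (s := Finset.range d) (f := fun k => Real.sqrt (c k))
    simp_rw [Real.sq_sqrt (hc0 _)] at h1
    rwa [hcn, Finset.card_range] at h1
  have hRpos : 0 < R := by
    refine (Finset.sum_nonneg fun k _ => Real.sqrt_nonneg _).lt_of_ne' fun h0 => ?_
    have h1 := (Finset.sum_eq_zero_iff_of_nonneg fun k _ => Real.sqrt_nonneg (c k)).1 h0
    have h2 : ∑ k ∈ Finset.range d, c k = 0 := Finset.sum_eq_zero fun k hk =>
      (Real.sqrt_eq_zero (hc0 k)).1 (h1 k hk)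
    rw [hcn] at h2
    have : n = 0 := by exact_mod_cast h2
    omega
  set w : ℕ → ℝ := fun k => Real.sqrt (c k) / R with hw
  have hw0 : ∀ k, 0 ≤ w k := fun k => div_nonneg (Real.sqrt_nonneg _) hRpos.le
  have hw1 : ∑ k ∈ Finset.range d, w k = 1 := by
    rw [hw, ← Finset.sum_div, ← hR, div_self hRpos.ne']
  -- An empty class has weight `0`, hence `x / w k = 0` by convention; its sum is `0` as well.
  have hwS : ∀ k ω, w k * (x / w k * classSum X φ d k n ω) = x * classSum X φ d k n ω := by
    intro k ω
    by_cases hk : c k = 0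
    · have : classSum X φ d k n ω = 0 := by
        have : (Finset.range n).filter (fun j => j % d = k) = ∅ := by
          rw [← Finset.card_eq_zero]; simpa [hc] using hk
        rw [classSum, this, Finset.sum_empty]
      rw [this]; ring
    · have : w k ≠ 0 := div_ne_zero (fun h => hk ((Real.sqrt_eq_zero (hc0 k)).1 h)) hRpos.ne'
      field_simp
  have hmeas : ∀ k, Measurable (classSum X φ d k n) := fun k => by
    unfold classSum
    exact Finset.measurable_sum _ fun j _ => (((hXm j).mono (hℱm _) le_rfl).sub_const φ)
  have hint : ∀ k, Integrable (fun ω => Real.exp (x / w k * classSum X φ d k n ω)) prob := by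
    intro k
    refine integrable_of_measurable_of_abs_le
      (Real.measurable_exp.comp ((hmeas k).const_mul _))
      (b := Real.exp (x / w k * (n * (1 + φ)))) fun ω => ?_
    rw [abs_of_pos (Real.exp_pos _)]
    exact Real.exp_le_exp.2 (mul_le_mul_of_nonneg_left
      ((le_abs_self _).trans (abs_classSum_le hφ hX d k n ω)) (div_nonneg hx (hw0 k)))
  have hpt : ∀ ω, Real.exp (x * ∑ j ∈ Finset.range n, (X j ω - φ))
      ≤ ∑ k ∈ Finset.range d, w k * Real.exp (x / w k * classSum X φ d k n ω) := by
    intro ω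
    have := convexOn_exp.map_sum_le (t := Finset.range d) (w := w)
      (p := fun k => x / w k * classSum X φ d k n ω) (fun k _ => hw0 k) hw1
      (fun k _ => Set.mem_univ _)
    simp only [smul_eq_mul, hwS] at this
    rwa [← Finset.mul_sum, sum_classSum X φ hd] at this
  calc ∫ ω, Real.exp (x * ∑ j ∈ Finset.range n, (X j ω - φ)) ∂prob
      ≤ ∫ ω, ∑ k ∈ Finset.range d, w k * Real.exp (x / w k * classSum X φ d k n ω) ∂prob :=
        integral_mono_of_nonneg (Filter.Eventually.of_forall fun ω => (Real.exp_pos _).le)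
          (integrable_finsetSum _ fun k _ => (hint k).const_mul _) (Filter.Eventually.of_forall hpt)
    _ = ∑ k ∈ Finset.range d, w k * ∫ ω, Real.exp (x / w k * classSum X φ d k n ω) ∂prob := by
        rw [integral_finsetSum _ fun k _ => (hint k).const_mul _]
        simp_rw [integral_const_mul]
    _ ≤ ∑ k ∈ Finset.range d, w k * Real.exp (x ^ 2 / 2 * (d * n)) := by
        refine Finset.sum_le_sum fun k _ => ?_
        by_cases hk : w k = 0
        · simp [hk]
        refine mul_le_mul_of_nonneg_left ?_ (hw0 k)
        refine (integral_exp_classSum_le hℱ hℱm hX hXm hφ hXφ k n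
          (div_nonneg hx (hw0 k))).trans (Real.exp_le_exp.2 ?_)
        have hck : c k ≠ 0 := fun h => hk (by simp [hw, h])
        have : (x / w k) ^ 2 / 2 * c k = x ^ 2 / 2 * R ^ 2 := by
          rw [div_pow, hw, div_pow, Real.sq_sqrt (hc0 k)]
          field_simp
        change (x / w k) ^ 2 / 2 * c k ≤ _
        rw [this]
        exact mul_le_mul_of_nonneg_left hRsq (by positivity)
    _ = _ := by rw [← Finset.sum_mul, hw1, one_mul]

/-- A Hoeffding bound for bounded variables whose conditional expectations with a delay `d`
are at most `φ`. -/
theorem measure_sum_ge_le {ℱ : ℕ → MeasurableSpace Ω} (hℱ : Monotone ℱ)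
    (hℱm : ∀ j, ℱ j ≤ mΩ) {X : ℕ → Ω → ℝ} (hX : ∀ j ω, |X j ω| ≤ 1)
    (hXm : ∀ j, Measurable[ℱ (j + 1)] (X j)) {φ : ℝ} (hφ : 0 ≤ φ) {d : ℕ} (hd : 1 ≤ d)
    (hXφ : ∀ (j : ℕ) (Y : Ω → ℝ) (b : ℝ), Measurable[ℱ (j + 1 - d)] Y → (∀ ω, 0 ≤ Y ω) →
      (∀ ω, Y ω ≤ b) → ∫ ω, Y ω * X j ω ∂prob ≤ φ * ∫ ω, Y ω ∂prob)
    {n : ℕ} (hn : 1 ≤ n) {D : ℝ} (hD : d ≤ D) {δ : ℝ} (hδ : 0 < δ) (hδ1 : δ ≤ 1) :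
    prob {ω | n * Real.sqrt (2 * D * Real.log (1 / δ) / n)
        ≤ ∑ j ∈ Finset.range n, (X j ω - φ)} ≤ ENNReal.ofReal δ := by
  have hD0 : 0 < D := lt_of_lt_of_le (by exact_mod_cast hd) hD
  have hn0 : (0 : ℝ) < n := by exact_mod_cast hn
  have hlog : 0 ≤ Real.log (1 / δ) := Real.log_nonneg (by rw [le_div_iff₀ hδ]; linarith)
  set r := Real.sqrt (2 * D * Real.log (1 / δ) / n) with hr
  have hr0 : 0 ≤ r := Real.sqrt_nonneg _
  have hr2 : r ^ 2 = 2 * D * Real.log (1 / δ) / n := Real.sq_sqrt (by positivity)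
  -- The minimizer of the Chernoff exponent `-x * n * r + x ^ 2 * D * n / 2`.
  set x := r / D with hxdef
  have hx : 0 ≤ x := by positivity
  set S : Ω → ℝ := fun ω => ∑ j ∈ Finset.range n, (X j ω - φ) with hS
  have hSm : Measurable S :=
    Finset.measurable_sum _ fun j _ => (((hXm j).mono (hℱm _) le_rfl).sub_const φ)
  have hSb : ∀ ω, |S ω| ≤ n * (1 + φ) := fun ω => by
    refine (Finset.abs_sum_le_sum_abs _ _).trans ?_
    refine (Finset.sum_le_card_nsmul _ _ (1 + φ) fun j _ => ?_).trans (by simp [mul_add])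
    exact (abs_sub _ _).trans (add_le_add (hX j ω) (abs_of_nonneg hφ).le)
  have hint : Integrable (fun ω => Real.exp (x * S ω)) prob := by
    refine integrable_of_measurable_of_abs_le (Real.measurable_exp.comp (hSm.const_mul _))
      (b := Real.exp (x * (n * (1 + φ)))) fun ω => ?_
    rw [abs_of_pos (Real.exp_pos _)]
    exact Real.exp_le_exp.2 (mul_le_mul_of_nonneg_left ((le_abs_self _).trans (hSb ω)) hx)
  have hch := ProbabilityTheory.measure_ge_le_exp_mul_mgf (μ := prob) (X := S) (n * r) hx hint
  have hmgf := integral_exp_sum_le hℱ hℱm hX hXm hφ hd hXφ hn hx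
  rw [← ENNReal.ofReal_toReal (measure_ne_top prob _)]
  refine ENNReal.ofReal_le_ofReal (hch.trans ?_)
  calc Real.exp (-x * (n * r)) * ProbabilityTheory.mgf S prob x
      ≤ Real.exp (-x * (n * r)) * Real.exp (x ^ 2 / 2 * (D * n)) := by
        refine mul_le_mul_of_nonneg_left (hmgf.trans (Real.exp_le_exp.2 ?_)) (Real.exp_pos _).le
        gcongr
    _ = Real.exp (-Real.log (1 / δ)) := by
        rw [← Real.exp_add]
        congr 1
        have : -x * (n * r) + x ^ 2 / 2 * (D * n) = - (r ^ 2 * n / (2 * D)) := by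
          rw [hxdef]; field_simp; ring
        rw [this, hr2]; field_simp
    _ = δ := by rw [one_div, Real.log_inv, neg_neg, Real.exp_log hδ]

end Concentration

/-! ### Regret of delayed follow-the-regularized-leader with approximate minimizers -/

section Regret

variable {W : Type*} [MeasurableSpace W]

lemma normDist_nonneg (N : Seminorm ℝ (SignedMeasure W)) (P P' : ProbabilityMeasure W) :
    0 ≤ normDist N P P' := apply_nonneg N _

lemma normDist_comm (N : Seminorm ℝ (SignedMeasure W)) (P P' : ProbabilityMeasure W) :
    normDist N P P' = normDist N P' P := map_sub_rev N _ _

lemma normDist_triangle (N : Seminorm ℝ (SignedMeasure W)) (P P' P'' : ProbabilityMeasure W) :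
    normDist N P P'' ≤ normDist N P P' + normDist N P' P'' := by
  unfold normDist
  rw [← sub_add_sub_cancel _ ((P' : Measure W).toSignedMeasure)]
  exact map_add_le_add N _ _

lemma integral_sub_le_of_dualNorm_le {N : Seminorm ℝ (SignedMeasure W)} (hN : IsNorm N)
    {f : W → ℝ} {B : ℝ} (hf : dualNorm N f ≤ B) (P P' : ProbabilityMeasure W)
    (hP : Integrable f (P : Measure W)) (hP' : Integrable f (P' : Measure W)) :
    ∫ w, f w ∂(P : Measure W) - ∫ w, f w ∂(P' : Measure W) ≤ B * normDist N P P' := by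
  set Q : SignedMeasure W := (P : Measure W).toSignedMeasure - (P' : Measure W).toSignedMeasure
    with hQ
  have hint : ∫ᵛ w, f w ∂<•Q = ∫ w, f w ∂(P : Measure W) - ∫ w, f w ∂(P' : Measure W) := by
    rw [hQ, VectorMeasure.integral_sub_vectorMeasure]
    · simp
    · simpa [VectorMeasure.Integrable] using hP
    · simpa [VectorMeasure.Integrable] using hP'
  rw [← hint]
  change _ ≤ B * N Q
  -- The difference is normalized to apply the dual norm; definiteness covers the case where this is
  -- impossible.
  by_cases h0 : N Q = 0
  · simp [hN Q h0]
  have hpos : 0 < N Q := (apply_nonneg N Q).lt_of_ne' h0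
  have h1 : N ((N Q)⁻¹ • Q) ≤ 1 := by
    rw [map_smul_eq_mul, Real.norm_of_nonneg (inv_nonneg.2 hpos.le), inv_mul_cancel₀ h0]
  have h2 : ((∫ᵛ w, f w ∂<•((N Q)⁻¹ • Q) : ℝ) : EReal) ≤ B :=
    (le_iSup₂ (f := fun (Q : SignedMeasure W) (_ : N Q ≤ 1) => ((∫ᵛ w, f w ∂<•Q : ℝ) : EReal))
      _ h1).trans hf
  rw [EReal.coe_le_coe_iff, VectorMeasure.integral_smul_vectorMeasure, smul_eq_mul,
    inv_mul_le_iff₀ hpos] at h2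
  linarith

lemma integral_mix {f : W → ℝ} (hf : ∀ P : ProbabilityMeasure W, Integrable f (P : Measure W))
    (r : ℝ) (hr : r ∈ Set.Icc (0 : ℝ) 1) (P P' : ProbabilityMeasure W) :
    ∫ w, f w ∂(mix r hr P P' : Measure W)
      = r * ∫ w, f w ∂(P : Measure W) + (1 - r) * ∫ w, f w ∂(P' : Measure W) := by
  change ∫ w, f w ∂(ENNReal.ofReal r • (P : Measure W)
    + ENNReal.ofReal (1 - r) • (P' : Measure W)) = _
  rw [integral_add_measure ((hf P).smul_measure ENNReal.ofReal_ne_top)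
    ((hf P').smul_measure ENNReal.ofReal_ne_top), integral_smul_measure, integral_smul_measure,
    ENNReal.toReal_ofReal hr.1, ENNReal.toReal_ofReal (sub_nonneg.2 hr.2), smul_eq_mul, smul_eq_mul]

variable {N : Seminorm ℝ (SignedMeasure W)} {α : ℝ} {h : ProbabilityMeasure W → EReal}

lemma IsRegularizer.coe_toReal (hreg : IsRegularizer N α h) {P : ProbabilityMeasure W}
    (hP : h P ≠ ⊤) : ((h P).toReal : EReal) = h P :=
  EReal.coe_toReal hP (hreg.ne_bot P)

lemma IsRegularizer.mix_le (hreg : IsRegularizer N α h) {P P' : ProbabilityMeasure W}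
    (hP : h P ≠ ⊤) (hP' : h P' ≠ ⊤) (r : ℝ) (hr : r ∈ Set.Icc (0 : ℝ) 1) :
    h (mix r hr P P') ≠ ⊤ ∧ (h (mix r hr P P')).toReal ≤ r * (h P).toReal
      + (1 - r) * (h P').toReal - α * r * (1 - r) / 2 * normDist N P P' ^ 2 := by
  have h1 := hreg.strongConvex P P' r hr
  rw [← hreg.coe_toReal hP, ← hreg.coe_toReal hP'] at h1
  have h2 : h (mix r hr P P') ≤ ((r * (h P).toReal
      + (1 - r) * (h P').toReal - α * r * (1 - r) / 2 * normDist N P P' ^ 2 : ℝ) : EReal) := by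
    simpa only [EReal.coe_sub, EReal.coe_add, EReal.coe_mul] using h1
  have h3 : h (mix r hr P P') ≠ ⊤ := (h2.trans_lt (EReal.coe_lt_top _)).ne
  refine ⟨h3, ?_⟩
  rwa [← hreg.coe_toReal h3, EReal.coe_le_coe_iff] at h2

/-- Quadratic growth of a strongly convex function around an approximate minimizer. -/
lemma IsRegularizer.growth (hreg : IsRegularizer N α h) {A : ProbabilityMeasure W → ℝ}
    (hA : ∀ r hr P P', A (mix r hr P P') = r * A P + (1 - r) * A P')
    {P Q : ProbabilityMeasure W} (hP : h P ≠ ⊤) (hQ : h Q ≠ ⊤) {s : ℝ} (hs : 0 < s) (hs1 : s < 1)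
    (hmin : ∀ Q, h Q ≠ ⊤ → A P + (h P).toReal ≤ A Q + (h Q).toReal + s ^ 2) :
    A P + (h P).toReal + α * (1 - s) / 2 * normDist N P Q ^ 2 - s ≤ A Q + (h Q).toReal := by
  -- The competitor is `(1 - s) P + s Q`. The gain is of order `s`, so after division by `s` the
  -- error `s ^ 2` leaves only `s`.
  have hr : 1 - s ∈ Set.Icc (0 : ℝ) 1 := ⟨by linarith, by linarith⟩
  obtain ⟨h1, h2⟩ := hreg.mix_le hP hQ (1 - s) hr
  have h3 := hmin _ h1
  rw [hA] at h3
  have h4 : s * (A P + (h P).toReal + α * (1 - s) / 2 * normDist N P Q ^ 2 - s)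
      ≤ s * (A Q + (h Q).toReal) := by nlinarith
  exact le_of_mul_le_mul_left h4 hs

lemma mul_sub_sq_le {a b x : ℝ} (ha : 0 < a) : b * x - a / 2 * x ^ 2 ≤ b ^ 2 / (2 * a) := by
  rw [le_div_iff₀ (by positivity)]
  nlinarith [sq_nonneg (b - a * x)]

/-- The accumulated cost `∑ g i P` over the past rounds `i < m` with `i ≡ k (mod d)`. -/
def pastCost (g : ℕ → ProbabilityMeasure W → ℝ) (d k m : ℕ) (P : ProbabilityMeasure W) : ℝ :=
  ∑ i ∈ (Finset.range m).filter (fun i => i % d = k), g i P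

/-- Be-the-leader induction: the hypothesis is applied at the leader `p m`, and quadratic growth
passes from `p m` to `Q`. The growth term absorbs the change `ηB‖p m - Q‖` of the current cost by
completing the square. -/
lemma IsRegularizer.regret_class (hreg : IsRegularizer N α h) (hα : 0 < α)
    {g : ℕ → ProbabilityMeasure W → ℝ}
    (hg : ∀ i r hr P P', g i (mix r hr P P') = r * g i P + (1 - r) * g i P')
    {B η s : ℝ} (hη : 0 < η) (hs : 0 < s) (hs1 : s < 1) {n d : ℕ}
    (hgB : ∀ i < n, ∀ P P', g i P - g i P' ≤ B * normDist N P P')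
    {P₁ : ProbabilityMeasure W} (hP₁ : ∀ P, h P₁ ≤ h P)
    {p : ℕ → ProbabilityMeasure W} (hp : ∀ j, h (p j) ≠ ⊤)
    (hmin : ∀ j < n, ∀ Q, h Q ≠ ⊤ → η * pastCost g d (j % d) j (p j) + (h (p j)).toReal
      ≤ η * pastCost g d (j % d) j Q + (h Q).toReal + s ^ 2)
    (k m : ℕ) (hm : m ≤ n) {Q : ProbabilityMeasure W} (hQ : h Q ≠ ⊤) :
    (h P₁).toReal + ∑ j ∈ (Finset.range m).filter (fun j => j % d = k),
        (η * g j (p j) - ((η * B) ^ 2 / (2 * (α * (1 - s))) + s))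
      ≤ η * pastCost g d k m Q + (h Q).toReal := by
  induction m generalizing Q with
  | zero =>
    simpa [pastCost] using EReal.toReal_le_toReal (hP₁ Q) (hreg.ne_bot _) hQ
  | succ m ih =>
    by_cases hk : m % d = k
    swap
    · rw [pastCost, Finset.range_add_one, Finset.filter_insert, if_neg hk]
      exact ih (by omega) hQ
    rw [pastCost, Finset.range_add_one, Finset.filter_insert, if_pos hk,
      Finset.sum_insert (by simp), Finset.sum_insert (by simp), mul_add]
    have h1 := ih (by omega) (hp m)
    have hA : ∀ r hr P P', η * pastCost g d k m (mix r hr P P')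
        = r * (η * pastCost g d k m P) + (1 - r) * (η * pastCost g d k m P') := by
      intro r hr P P'
      simp only [pastCost, hg, Finset.sum_add_distrib, ← Finset.mul_sum]
      ring
    have hmin' := hmin m (by omega)
    rw [hk] at hmin'
    have h2 := hreg.growth (A := fun P => η * pastCost g d k m P) hA (hp m) hQ hs hs1 hmin'
    have h3 := mul_le_mul_of_nonneg_left (hgB m (by omega) (p m) Q) hη.le
    have h4 := mul_sub_sq_le (a := α * (1 - s)) (b := η * B) (x := normDist N (p m) Q)
      (mul_pos hα (by linarith))
    change _ ≤ η * g m Q + η * pastCost g d k m Q + _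
    nlinarith

/-- Regret bound for `d`-delayed follow-the-regularized-leader, run separately on the residue
classes modulo `d`, with approximate minimizers. -/
theorem IsRegularizer.regret (hreg : IsRegularizer N α h) (hα : 0 < α)
    {g : ℕ → ProbabilityMeasure W → ℝ}
    (hg : ∀ i r hr P P', g i (mix r hr P P') = r * g i P + (1 - r) * g i P')
    {B η s : ℝ} (hη : 0 < η) (hs : 0 < s) (hs1 : s < 1) {n d : ℕ} (hd : 1 ≤ d)
    (hgB : ∀ i < n, ∀ P P', g i P - g i P' ≤ B * normDist N P P')
    {P₁ : ProbabilityMeasure W} (hP₁ : ∀ P, h P₁ ≤ h P)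
    {p : ℕ → ProbabilityMeasure W} (hp : ∀ j, h (p j) ≠ ⊤)
    (hmin : ∀ j < n, ∀ Q, h Q ≠ ⊤ → η * pastCost g d (j % d) j (p j) + (h (p j)).toReal
      ≤ η * pastCost g d (j % d) j Q + (h Q).toReal + s ^ 2)
    {Q : ProbabilityMeasure W} (hQ : h Q ≠ ⊤) :
    η * ∑ j ∈ Finset.range n, (g j (p j) - g j Q) ≤ d * ((h Q).toReal - (h P₁).toReal)
      + n * ((η * B) ^ 2 / (2 * (α * (1 - s))) + s) := by
  set K := (η * B) ^ 2 / (2 * (α * (1 - s))) + s with hK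
  have hmaps : ∀ j ∈ Finset.range n, j % d ∈ Finset.range d :=
    fun j _ => Finset.mem_range.2 (Nat.mod_lt j (by omega))
  -- Each of the `d` classes pays `h Q - h P₁` once.
  have h1 := Finset.sum_le_sum fun k (_ : k ∈ Finset.range d) =>
    hreg.regret_class hα hg hη hs hs1 hgB hP₁ hp hmin k n le_rfl hQ
  simp only [Finset.sum_add_distrib, ← Finset.mul_sum, pastCost] at h1
  rw [Finset.sum_fiberwise_of_maps_to hmaps, Finset.sum_fiberwise_of_maps_to hmaps,
    Finset.sum_sub_distrib] at h1
  simp only [Finset.sum_const, Finset.card_range, nsmul_eq_mul, ← Finset.mul_sum] at h1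
  rw [Finset.sum_sub_distrib]
  nlinarith

/-- A countable family which is dense in the graph of `h` over its effective domain. -/
lemma exists_graph_dense (hsep : HasSeparableDomain N h) (hproper : ∃ P, h P ≠ ⊤) :
    ∃ e : ℕ → ProbabilityMeasure W, (∀ i, h (e i) ≠ ⊤) ∧ ∀ P, h P ≠ ⊤ → ∀ ε : ℝ, 0 < ε →
      ∃ i, normDist N P (e i) < ε ∧ |(h P).toReal - (h (e i)).toReal| < ε := by
  obtain ⟨D, hD, hdense⟩ := hsep
  have : Countable D := hD
  -- Lower semi-continuity does not make `h` close at close points, and `D` may leave the domain. So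
  -- cells record a centre, a rational value of `h` and a tolerance, and one domain point is chosen
  -- in each nonempty cell.
  let R : D × ℚ × ℕ → ProbabilityMeasure W → Prop := fun x P =>
    h P ≠ ⊤ ∧ normDist N P x.1 < 1 / ((x.2.2 : ℝ) + 1) ∧
      |(h P).toReal - x.2.1| < 1 / ((x.2.2 : ℝ) + 1)
  have hfam : ∀ P, h P ≠ ⊤ → ∀ ε : ℝ, 0 < ε → ∃ x, R x P ∧ 1 / ((x.2.2 : ℝ) + 1) < ε / 2 := by
    intro P hP ε hε
    obtain ⟨m, hm⟩ := exists_nat_one_div_lt (half_pos hε)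
    have hm0 : (0 : ℝ) < 1 / ((m : ℝ) + 1) := by positivity
    obtain ⟨P', hP'D, hP'⟩ := hdense P (lt_top_iff_ne_top.2 hP) _ hm0
    obtain ⟨q, hq1, hq2⟩ := exists_rat_btwn (show (h P).toReal - 1 / ((m : ℝ) + 1) < (h P).toReal
      by linarith)
    exact ⟨(⟨P', hP'D⟩, q, m), ⟨hP, hP', by rw [abs_of_pos (by linarith)]; linarith⟩, hm⟩
  let I := {x : D × ℚ × ℕ // ∃ P, R x P}
  obtain ⟨P₀, hP₀⟩ := hproper
  obtain ⟨x₀, hx₀, -⟩ := hfam P₀ hP₀ 1 one_pos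
  have : Nonempty I := ⟨⟨x₀, P₀, hx₀⟩⟩
  obtain ⟨enum, henum⟩ := exists_surjective_nat I
  choose c hc using fun x : I => x.2
  refine ⟨fun i => c (enum i), fun i => (hc (enum i)).1, fun P hP ε hε => ?_⟩
  obtain ⟨x, hxP, hxε⟩ := hfam P hP ε hε
  obtain ⟨i, hi⟩ := henum ⟨x, P, hxP⟩
  refine ⟨i, ?_⟩
  beta_reduce
  have hspec : R x (c (enum i)) := by
    have := hc (enum i)
    rwa [show (enum i).1 = x by rw [hi]] at this
  generalize c (enum i) = P' at hspec ⊢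
  constructor
  · have := normDist_triangle N P x.1 P'
    rw [normDist_comm N (x.1 : ProbabilityMeasure W) P'] at this
    linarith [hspec.2.1, hxP.2.1]
  · have := abs_sub_le (h P).toReal x.2.1 (h P').toReal
    rw [abs_sub_comm (x.2.1 : ℝ)] at this
    linarith [hspec.2.2, hxP.2.2]

/-- Approximate minimality over a graph-dense family extends to the effective domain. -/
lemma le_of_forall_graph_dense {e : ℕ → ProbabilityMeasure W}
    (hdense : ∀ P, h P ≠ ⊤ → ∀ ε : ℝ, 0 < ε →
      ∃ i, normDist N P (e i) < ε ∧ |(h P).toReal - (h (e i)).toReal| < ε)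
    {A : ProbabilityMeasure W → ℝ} {L : ℝ} (hL : 0 ≤ L)
    (hA : ∀ P P', A P - A P' ≤ L * normDist N P P') {a : ℝ}
    (ha : ∀ i, a ≤ A (e i) + (h (e i)).toReal) {Q : ProbabilityMeasure W} (hQ : h Q ≠ ⊤) :
    a ≤ A Q + (h Q).toReal := by
  refine le_of_forall_pos_le_add fun ε hε => ?_
  obtain ⟨i, hi1, hi2⟩ := hdense Q hQ (ε / (L + 1)) (by positivity)
  have h1 := hA (e i) Q
  rw [normDist_comm] at h1
  have h2 := mul_le_mul_of_nonneg_left hi1.le hL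
  have h3 : L * (ε / (L + 1)) + ε / (L + 1) = ε := by field_simp
  have h4 := (abs_lt.1 hi2).1
  linarith [ha i]

end Regret

/-! ### The generalization game -/

section Game

variable {Ω 𝒵 W : Type*} [MeasurableSpace 𝒵] [MeasurableSpace W]

/-- The expected cost `⟨P, ℓ(·, z) - L⟩` of the prediction `P` when `z` is observed. -/
def expCost (ℓ : W → 𝒵 → ℝ) (μ : Measure 𝒵) (z : 𝒵) (P : ProbabilityMeasure W) : ℝ :=
  ∫ w, cost ℓ μ z w ∂(P : Measure W)

variable {ℓ : W → 𝒵 → ℝ} {μ : Measure 𝒵} [IsProbabilityMeasure μ]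

lemma measurable_testError (hℓ_meas : Measurable (Function.uncurry ℓ)) :
    Measurable (testError ℓ μ) :=
  (StronglyMeasurable.integral_prod_right (f := ℓ)
    hℓ_meas.stronglyMeasurable).measurable

lemma measurable_cost (hℓ_meas : Measurable (Function.uncurry ℓ)) :
    Measurable (fun x : 𝒵 × W => cost ℓ μ x.1 x.2) :=
  (hℓ_meas.comp measurable_swap).sub ((measurable_testError hℓ_meas).comp measurable_snd)

lemma testError_mem {W : Type*} {ℓ : W → 𝒵 → ℝ} (hℓ : ∀ w z, ℓ w z ∈ Set.Icc (0 : ℝ) 1) (w : W) :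
    testError ℓ μ w ∈ Set.Icc (0 : ℝ) 1 := by
  refine ⟨integral_nonneg fun z => (hℓ w z).1, ?_⟩
  have := integral_mono_of_nonneg (μ := μ) (f := ℓ w) (g := fun _ => (1 : ℝ))
    (Filter.Eventually.of_forall fun z => (hℓ w z).1) (integrable_const _)
    (Filter.Eventually.of_forall fun z => (hℓ w z).2)
  simpa [testError] using this

lemma abs_cost_le {W : Type*} {ℓ : W → 𝒵 → ℝ} (hℓ : ∀ w z, ℓ w z ∈ Set.Icc (0 : ℝ) 1) (z : 𝒵) (w : W) :
    |cost ℓ μ z w| ≤ 1 := by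
  have h1 := hℓ w z
  have h2 := testError_mem (μ := μ) hℓ w
  rw [cost, abs_le]
  constructor <;> linarith [h1.1, h1.2, h2.1, h2.2]

lemma integrable_cost (hℓ_meas : Measurable (Function.uncurry ℓ))
    (hℓ : ∀ w z, ℓ w z ∈ Set.Icc (0 : ℝ) 1) (z : 𝒵) (P : ProbabilityMeasure W) :
    Integrable (cost ℓ μ z) (P : Measure W) :=
  integrable_of_measurable_of_abs_le ((measurable_cost hℓ_meas).comp measurable_prodMk_left)
    (abs_cost_le hℓ z)

lemma measurable_expCost (hℓ_meas : Measurable (Function.uncurry ℓ)) (P : ProbabilityMeasure W) :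
    Measurable (fun z => expCost ℓ μ z P) :=
  (StronglyMeasurable.integral_prod_right (ν := (P : Measure W))
    (f := cost ℓ μ)
    (measurable_cost hℓ_meas).stronglyMeasurable).measurable

lemma abs_expCost_le (hℓ : ∀ w z, ℓ w z ∈ Set.Icc (0 : ℝ) 1) (z : 𝒵) (P : ProbabilityMeasure W) :
    |expCost ℓ μ z P| ≤ 1 := by
  have := norm_integral_le_of_norm_le_const (μ := (P : Measure W)) (f := cost ℓ μ z) (C := 1)
    (Filter.Eventually.of_forall (abs_cost_le hℓ z))
  simpa [expCost] using this

/-- An algorithm enters only through its output measure, so uniformity over measures gives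
uniformity over algorithms. -/
lemma gen_eq (hℓ_meas : Measurable (Function.uncurry ℓ))
    (hℓ : ∀ w z, ℓ w z ∈ Set.Icc (0 : ℝ) 1) (Z : ℕ → Ω → 𝒵) {n : ℕ} (hn : 1 ≤ n)
    (𝒜 : ProbabilityTheory.Kernel (Fin n → 𝒵) W) [ProbabilityTheory.IsMarkovKernel 𝒜] (ω : Ω) :
    gen ℓ μ 𝒜 (sample Z n ω) = (1 / (n : ℝ)) * -∑ j ∈ Finset.range n,
      expCost ℓ μ (Z (j + 1) ω) (output 𝒜 (sample Z n ω)) := by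
  have hn0 : (n : ℝ) ≠ 0 := by positivity
  unfold expCost
  rw [← integral_finsetSum _ fun j _ => integrable_cost hℓ_meas hℓ _ _, ← integral_neg,
    ← integral_const_mul, gen]
  refine integral_congr_ae (Filter.Eventually.of_forall fun w => ?_)
  simp only [cost, trainError, sample, Finset.sum_sub_distrib, Finset.sum_const,
    Finset.card_range, nsmul_eq_mul]
  rw [Fin.sum_univ_eq_sum_range (fun j => ℓ w (Z (j + 1) ω))]
  field_simp
  ring

end Game

/-! ### Measurable choice of approximate minimizers -/

section Selection

/-- The first index within `ε` of the infimum works: testing an index takes countably many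
measurable comparisons. -/
lemma exists_measurable_approx_argmin {Ω : Type*} {m : MeasurableSpace Ω} {F : ℕ → Ω → ℝ}
    (hF : ∀ i, Measurable (F i)) (hb : ∀ ω, BddBelow (Set.range fun i => F i ω)) {ε : ℝ}
    (hε : 0 < ε) :
    ∃ I : Ω → ℕ, Measurable I ∧ ∀ ω i, F (I ω) ω ≤ F i ω + ε := by
  classical
  have hex : ∀ ω, ∃ i, ∀ i', F i ω ≤ F i' ω + ε := fun ω => by
    obtain ⟨i, hi⟩ := exists_lt_of_ciInf_lt
      (show ⨅ i, F i ω < (⨅ i, F i ω) + ε by linarith)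
    exact ⟨i, fun i' => by linarith [ciInf_le (hb ω) i']⟩
  refine ⟨fun ω => Nat.find (hex ω), measurable_find hex fun k => ?_,
    fun ω => Nat.find_spec (hex ω)⟩
  simp only [Set.ofPred_forall]
  exact MeasurableSet.iInter fun i' => measurableSet_le (hF k) ((hF i').add_const ε)

end Selection

/-! ### From mixing of single hypotheses to data-dependent predictions -/

section Mixing

variable {Ω 𝒵 W : Type*} {mΩ : MeasurableSpace Ω} [MeasurableSpace 𝒵] [MeasurableSpace W]
  {Z : ℕ → Ω → 𝒵}

lemma pastSigma_mono : Monotone (pastSigma Z) := fun _ _ hst =>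
  biSup_mono fun _ hi => Finset.Icc_subset_Icc_right hst hi

lemma pastSigma_le (hZ : ∀ t, 1 ≤ t → Measurable (Z t)) (s : ℕ) : pastSigma Z s ≤ mΩ :=
  iSup₂_le fun i hi => (hZ i (Finset.mem_Icc.1 hi).1).comap_le

lemma measurable_pastSigma {t s : ℕ} (ht : 1 ≤ t) (hts : t ≤ s) :
    Measurable[pastSigma Z s] (Z t) :=
  Measurable.of_comap_le (le_iSup₂_of_le t (Finset.mem_Icc.2 ⟨ht, hts⟩) le_rfl)

variable {prob : Measure Ω} [IsProbabilityMeasure prob] {ℓ : W → 𝒵 → ℝ} {φ : ℕ → ℝ}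

lemma isProbabilityMeasure_marginal (hZ : ∀ t, 1 ≤ t → Measurable (Z t)) :
    IsProbabilityMeasure (marginal prob Z) :=
  Measure.isProbabilityMeasure_map (hZ 1 le_rfl).aemeasurable

lemma integral_mul_le_of_mixes (hZ : ∀ t, 1 ≤ t → Measurable (Z t))
    (hℓ_meas : Measurable (Function.uncurry ℓ)) (hℓ : ∀ w z, ℓ w z ∈ Set.Icc (0 : ℝ) 1)
    (hmix : MixesAtRate prob Z ℓ φ) {t d : ℕ} (ht : 1 ≤ t) (hd : 1 ≤ d) (w : W) {Y : Ω → ℝ} {b : ℝ}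
    (hY : Measurable[pastSigma Z (t - d)] Y) (hY0 : ∀ ω, 0 ≤ Y ω) (hYb : ∀ ω, Y ω ≤ b) :
    ∫ ω, Y ω * -cost ℓ (marginal prob Z) (Z t ω) w ∂prob ≤ φ d * ∫ ω, Y ω ∂prob := by
  have := isProbabilityMeasure_marginal (prob := prob) hZ
  have hle := pastSigma_le hZ (t - d)
  set f : Ω → ℝ := fun ω => testError ℓ (marginal prob Z) w - ℓ w (Z t ω) with hf
  have hfc : ∀ ω, -cost ℓ (marginal prob Z) (Z t ω) w = f ω := fun ω => by rw [cost, neg_sub]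
  have hYm : Measurable Y := hY.mono hle le_rfl
  have hfm : Measurable f :=
    measurable_const.sub ((hℓ_meas.comp measurable_prodMk_left).comp (hZ t ht))
  have hfb : ∀ ω, |f ω| ≤ 1 := fun ω => by
    rw [← hfc, abs_neg]; exact abs_cost_le hℓ _ _
  have hfi : Integrable f prob := integrable_of_measurable_of_abs_le hfm hfb
  have hYabs : ∀ ω, |Y ω| ≤ b := fun ω => by rw [abs_of_nonneg (hY0 ω)]; exact hYb ω
  have hYi : Integrable Y prob := integrable_of_measurable_of_abs_le hYm hYabs
  have hYfi : Integrable (Y * f) prob :=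
    integrable_of_measurable_of_abs_le (hYm.mul hfm) (b := b * 1) fun ω => by
      rw [Pi.mul_apply, abs_mul]
      exact mul_le_mul (hYabs ω) (hfb ω) (abs_nonneg _) ((abs_nonneg _).trans (hYabs ω))
  have hpull := condExp_mul_of_stronglyMeasurable_left (m := pastSigma Z (t - d))
    hY.stronglyMeasurable hYfi hfi
  calc ∫ ω, Y ω * -cost ℓ (marginal prob Z) (Z t ω) w ∂prob = ∫ ω, (Y * f) ω ∂prob := by
        simp_rw [hfc, Pi.mul_apply]
    _ = ∫ ω, (prob[Y * f | pastSigma Z (t - d)]) ω ∂prob := (integral_condExp hle).symm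
    _ ≤ ∫ ω, φ d * Y ω ∂prob := by
        refine integral_mono_ae integrable_condExp (hYi.const_mul _) ?_
        filter_upwards [hpull, hmix.condExp_le w t d ht hd] with ω h1 h2
        rw [h1, Pi.mul_apply, mul_comm (φ d)]
        exact mul_le_mul_of_nonneg_left h2 (hY0 ω)
    _ = _ := integral_const_mul _ _

/-- The null set in the mixing condition depends on `w`. Integrating against `Y` first removes it,
and Fubini then averages over `P`. -/
lemma integral_mul_expCost_le (hZ : ∀ t, 1 ≤ t → Measurable (Z t))
    (hℓ_meas : Measurable (Function.uncurry ℓ)) (hℓ : ∀ w z, ℓ w z ∈ Set.Icc (0 : ℝ) 1)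
    (hmix : MixesAtRate prob Z ℓ φ) {t d : ℕ} (ht : 1 ≤ t) (hd : 1 ≤ d) (P : ProbabilityMeasure W)
    {Y : Ω → ℝ} {b : ℝ} (hY : Measurable[pastSigma Z (t - d)] Y) (hY0 : ∀ ω, 0 ≤ Y ω)
    (hYb : ∀ ω, Y ω ≤ b) :
    ∫ ω, Y ω * -expCost ℓ (marginal prob Z) (Z t ω) P ∂prob ≤ φ d * ∫ ω, Y ω ∂prob := by
  have := isProbabilityMeasure_marginal (prob := prob) hZ
  have hYm : Measurable Y := hY.mono (pastSigma_le hZ _) le_rfl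
  have hYabs : ∀ ω, |Y ω| ≤ b := fun ω => by rw [abs_of_nonneg (hY0 ω)]; exact hYb ω
  have hint : Integrable
      (Function.uncurry fun ω w => Y ω * -cost ℓ (marginal prob Z) (Z t ω) w)
      (prob.prod (P : Measure W)) := by
    refine integrable_of_measurable_of_abs_le (b := b * 1) ?_ fun x => ?_
    · exact (hYm.comp measurable_fst).mul ((measurable_cost hℓ_meas).comp
        (((hZ t ht).comp measurable_fst).prodMk measurable_snd)).neg
    · rw [Function.uncurry, abs_mul, abs_neg]
      exact mul_le_mul (hYabs _) (abs_cost_le hℓ _ _) (abs_nonneg _)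
        ((abs_nonneg _).trans (hYabs x.1))
  calc ∫ ω, Y ω * -expCost ℓ (marginal prob Z) (Z t ω) P ∂prob
      = ∫ ω, ∫ w, Y ω * -cost ℓ (marginal prob Z) (Z t ω) w ∂(P : Measure W) ∂prob := by
        simp_rw [integral_const_mul, integral_neg]; rfl
    _ = ∫ w, ∫ ω, Y ω * -cost ℓ (marginal prob Z) (Z t ω) w ∂prob ∂(P : Measure W) :=
        integral_integral_swap hint
    _ ≤ ∫ _, φ d * ∫ ω, Y ω ∂prob ∂(P : Measure W) :=
        integral_mono hint.integral_prod_right (integrable_const _) fun w =>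
          integral_mul_le_of_mixes hZ hℓ_meas hℓ hmix ht hd w hY hY0 hYb
    _ = _ := by simp

/-- The prediction takes countably many values, each on an event of the delayed past. Cutting `Y`
down to such an event gives another admissible test function, with a fixed measure. -/
lemma integral_mul_expCost_select_le (hZ : ∀ t, 1 ≤ t → Measurable (Z t))
    (hℓ_meas : Measurable (Function.uncurry ℓ)) (hℓ : ∀ w z, ℓ w z ∈ Set.Icc (0 : ℝ) 1)
    (hmix : MixesAtRate prob Z ℓ φ) {t d : ℕ} (ht : 1 ≤ t) (hd : 1 ≤ d)
    (e : ℕ → ProbabilityMeasure W) {I : Ω → ℕ} (hI : Measurable[pastSigma Z (t - d)] I)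
    (hXm : Measurable fun ω => expCost ℓ (marginal prob Z) (Z t ω) (e (I ω)))
    {Y : Ω → ℝ} {b : ℝ} (hY : Measurable[pastSigma Z (t - d)] Y) (hY0 : ∀ ω, 0 ≤ Y ω)
    (hYb : ∀ ω, Y ω ≤ b) :
    ∫ ω, Y ω * -expCost ℓ (marginal prob Z) (Z t ω) (e (I ω)) ∂prob
      ≤ φ d * ∫ ω, Y ω ∂prob := by
  have := isProbabilityMeasure_marginal (prob := prob) hZ
  have hle := pastSigma_le hZ (t - d)
  have hYm : Measurable Y := hY.mono hle le_rfl
  have hYabs : ∀ ω, |Y ω| ≤ b := fun ω => by rw [abs_of_nonneg (hY0 ω)]; exact hYb ω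
  have hYi : Integrable Y prob := integrable_of_measurable_of_abs_le hYm hYabs
  have hYXi : Integrable
      (fun ω => Y ω * -expCost ℓ (marginal prob Z) (Z t ω) (e (I ω))) prob :=
    integrable_of_measurable_of_abs_le (hYm.mul hXm.neg) (b := b * 1) fun ω => by
      rw [abs_mul, abs_neg]
      exact mul_le_mul (hYabs ω) (abs_expCost_le hℓ _ _) (abs_nonneg _)
        ((abs_nonneg _).trans (hYabs ω))
  set A : ℕ → Set Ω := fun i => I ⁻¹' {i} with hA
  have hAm' : ∀ i, MeasurableSet[pastSigma Z (t - d)] (A i) := fun i =>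
    hI (measurableSet_singleton i)
  have hAm : ∀ i, MeasurableSet (A i) := fun i => hle _ (hAm' i)
  have hAd : Pairwise (Function.onFun Disjoint A) := fun i j hij =>
    Disjoint.preimage I (Set.disjoint_singleton.2 hij)
  have hAu : ⋃ i, A i = Set.univ := by
    ext ω; simp [hA]
  have h1 := hasSum_integral_iUnion (μ := prob) hAm hAd (by rw [hAu]; exact hYXi.integrableOn)
  have h2 := (hasSum_integral_iUnion (μ := prob) hAm hAd
    (by rw [hAu]; exact hYi.integrableOn)).mul_left (φ d)
  rw [hAu, setIntegral_univ] at h1 h2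
  refine hasSum_le (fun i => ?_) h1 h2
  have h3 := integral_mul_expCost_le hZ hℓ_meas hℓ hmix ht hd (e i) (b := b)
    (Y := (A i).indicator Y) (hY.indicator (hAm' i))
    (fun ω => Set.indicator_nonneg (fun ω _ => hY0 ω) ω)
    (fun ω => (Set.indicator_le_self' (fun _ _ => hY0 _) ω).trans (hYb ω))
  rw [← integral_indicator (hAm i), ← integral_indicator (hAm i)]
  refine le_trans (le_of_eq (integral_congr_ae (Filter.Eventually.of_forall fun ω => ?_))) h3
  by_cases hω : ω ∈ A i
  · have : I ω = i := hω
    simp [hω, this]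
  · simp [hω]

end Mixing

/-! ### Online-to-PAC conversion -/

section Main

variable {Ω 𝒵 W : Type*} [MeasurableSpace Ω] [MeasurableSpace 𝒵] [MeasurableSpace W]
  {prob : Measure Ω} [IsProbabilityMeasure prob] {Z : ℕ → Ω → 𝒵} {ℓ : W → 𝒵 → ℝ} {φ : ℕ → ℝ}
  {N : Seminorm ℝ (SignedMeasure W)} {α : ℝ} {h : ProbabilityMeasure W → EReal}

/-- The generalization bound obtained from `s ^ 2`-approximate follow-the-regularized-leader. -/
theorem exists_event_gen_le (hZ : ∀ t, 1 ≤ t → Measurable (Z t))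
    (hℓ_meas : Measurable (Function.uncurry ℓ)) (hℓ : ∀ w z, ℓ w z ∈ Set.Icc (0 : ℝ) 1)
    (hmix : MixesAtRate prob Z ℓ φ) (hN : IsNorm N) (hα : 0 < α) (hreg : IsRegularizer N α h)
    (hsep : HasSeparableDomain N h) {P₁ : ProbabilityMeasure W} (hP₁ : ∀ P, h P₁ ≤ h P)
    {B η : ℝ} (hB : 0 < B) (hη : 0 < η) {n d : ℕ} (hn : 1 ≤ n) (hd : 1 ≤ d) {D : ℝ} (hD : d ≤ D)
    {δ : ℝ} (hδ : 0 < δ) (hδ1 : δ ≤ 1) {s : ℝ} (hs : 0 < s) (hs1 : s < 1) :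
    ∃ T : Set Ω, prob T ≤ ENNReal.ofReal δ ∧ ∀ ω ∉ T,
      (∀ j < n, dualNorm N (cost ℓ (marginal prob Z) (Z (j + 1) ω)) ≤ (B : EReal)) →
      ∀ Q, h Q ≠ ⊤ →
        η * -∑ j ∈ Finset.range n, expCost ℓ (marginal prob Z) (Z (j + 1) ω) Q
          ≤ D * ((h Q).toReal - (h P₁).toReal)
            + n * ((η * B) ^ 2 / (2 * (α * (1 - s))) + s)
            + η * (n * φ d + n * Real.sqrt (2 * D * Real.log (1 / δ) / n)) := by
  have := isProbabilityMeasure_marginal (prob := prob) hZ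
  set μ := marginal prob Z with hμ
  obtain ⟨e, he, hdense⟩ := exists_graph_dense hsep hreg.proper
  have hPreal : ∀ Q, h Q ≠ ⊤ → (h P₁).toReal ≤ (h Q).toReal := fun Q hQ =>
    EReal.toReal_le_toReal (hP₁ Q) (hreg.ne_bot _) hQ
  let g : Ω → ℕ → ProbabilityMeasure W → ℝ := fun ω i P => expCost ℓ μ (Z (i + 1) ω) P
  -- Round `j` uses only rounds `i` with `i + d ≤ j`, that is, the variables `Z (i + 1)` with `i + 1
  -- ≤ j + 1 - d`.
  have hsel : ∀ j, ∃ I : Ω → ℕ, Measurable[pastSigma Z (j + 1 - d)] I ∧ ∀ ω i,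
      η * pastCost (g ω) d (j % d) j (e (I ω)) + (h (e (I ω))).toReal
        ≤ η * pastCost (g ω) d (j % d) j (e i) + (h (e i)).toReal + s ^ 2 := by
    intro j
    refine exists_measurable_approx_argmin (m := pastSigma Z (j + 1 - d))
      (F := fun i ω => η * pastCost (g ω) d (j % d) j (e i) + (h (e i)).toReal)
      (fun i => ?_) (fun ω => ?_) (by positivity)
    · refine Measurable.add_const (Measurable.const_mul ?_ η) _
      unfold pastCost
      refine Finset.measurable_sum _ fun k hk => ?_
      rw [Finset.mem_filter, Finset.mem_range] at hk
      have := add_le_of_mod_eq hk.1 hk.2 rfl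
      exact (measurable_expCost hℓ_meas (e i)).comp (measurable_pastSigma (by omega) (by omega))
    · refine ⟨η * -j + (h P₁).toReal, ?_⟩
      rintro _ ⟨i, rfl⟩
      refine add_le_add (mul_le_mul_of_nonneg_left ?_ hη.le) (hPreal _ (he i))
      refine (abs_le.1 ((Finset.abs_sum_le_sum_abs _ _).trans ((Finset.sum_le_card_nsmul _ _ 1
        fun k _ => abs_expCost_le hℓ _ _).trans ?_))).1
      rw [nsmul_eq_mul, mul_one]
      exact_mod_cast (Finset.card_filter_le _ _).trans (Finset.card_range j).le
  choose I hIm hImin using hsel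
  set X : ℕ → Ω → ℝ := fun j ω => -g ω j (e (I j ω)) with hX
  have hgm : ∀ j, Measurable[pastSigma Z (j + 1)] fun ω => g ω j (e (I j ω)) := fun j => by
    have h1 : Measurable fun x : ℕ × 𝒵 => expCost ℓ μ x.2 (e x.1) :=
      measurable_from_prod_countable_right fun i => measurable_expCost hℓ_meas (e i)
    have h2 : Measurable[pastSigma Z (j + 1)] fun ω => (I j ω, Z (j + 1) ω) :=
      Measurable.prodMk ((hIm j).mono (pastSigma_mono (by omega)) le_rfl)
        (measurable_pastSigma (by omega) le_rfl)
    exact h1.comp h2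
  refine ⟨{ω | n * Real.sqrt (2 * D * Real.log (1 / δ) / n)
        ≤ ∑ j ∈ Finset.range n, (X j ω - φ d)},
    measure_sum_ge_le (ℱ := pastSigma Z) pastSigma_mono (pastSigma_le hZ)
      (fun j ω => (abs_neg _).trans_le (abs_expCost_le hℓ _ _)) (fun j => (hgm j).neg)
      (hmix.nonneg d hd) hd (fun j Y b hY hY0 hYb => ?_) hn hD hδ hδ1, fun ω hω hcost Q hQ => ?_⟩
  · exact integral_mul_expCost_select_le hZ hℓ_meas hℓ hmix (by omega) hd e (hIm j)
      ((hgm j).mono (pastSigma_le hZ _) le_rfl) hY hY0 hYb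
  · have hgB : ∀ i < n, ∀ P P', g ω i P - g ω i P' ≤ B * normDist N P P' := fun i hi P P' =>
      integral_sub_le_of_dualNorm_le hN (hcost i hi) P P' (integrable_cost hℓ_meas hℓ _ _)
        (integrable_cost hℓ_meas hℓ _ _)
    have hreg' := hreg.regret hα (g := g ω)
      (fun i r hr P P' => integral_mix (integrable_cost hℓ_meas hℓ _) r hr P P')
      hη hs hs1 hd hgB hP₁ (p := fun j => e (I j ω)) (fun j => he _)
      (fun j hj Q hQ => by
        -- The accumulated cost is Lipschitz with constant `n * B`, so near-minimality over the
        -- family extends to the whole domain.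
        have := le_of_forall_graph_dense hdense
          (A := fun P => η * pastCost (g ω) d (j % d) j P) (L := η * (n * B)) (by positivity)
          (fun P P' => ?_) (a := η * pastCost (g ω) d (j % d) j (e (I j ω))
            + (h (e (I j ω))).toReal - s ^ 2) (fun i => by linarith [hImin j ω i]) hQ
        · linarith
        · rw [← mul_sub, mul_assoc]
          refine mul_le_mul_of_nonneg_left ?_ hη.le
          rw [pastCost, pastCost, ← Finset.sum_sub_distrib]
          refine (Finset.sum_le_card_nsmul _ _ (B * normDist N P P') fun i hi => ?_).trans ?_
          · rw [Finset.mem_filter, Finset.mem_range] at hi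
            exact hgB i (by omega) P P'
          · rw [nsmul_eq_mul, mul_assoc]
            refine mul_le_mul_of_nonneg_right ?_ (mul_nonneg hB.le (normDist_nonneg N P P'))
            have := (Finset.card_filter_le (Finset.range j) (fun i => i % d = j % d)).trans
              (Finset.card_range j).le
            exact_mod_cast this.trans hj.le)
      hQ
    have h1 : (d : ℝ) * ((h Q).toReal - (h P₁).toReal) ≤ D * ((h Q).toReal - (h P₁).toReal) :=
      mul_le_mul_of_nonneg_right hD (sub_nonneg.2 (hPreal Q hQ))
    rw [Set.mem_ofPred_eq, not_le] at hω
    simp only [hX, Finset.sum_sub_distrib, Finset.sum_neg_distrib, Finset.sum_const,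
      Finset.card_range, nsmul_eq_mul] at hω
    have h2 := mul_le_mul_of_nonneg_left hω.le hη.le
    rw [Finset.sum_sub_distrib] at hreg'
    change η * -∑ j ∈ Finset.range n, g ω j Q ≤ _
    nlinarith

/-- The generalization bound obtained by letting the precision of the approximate minimizers tend
to `0`. -/
theorem exists_event_gen_le_limit (hZ : ∀ t, 1 ≤ t → Measurable (Z t))
    (hℓ_meas : Measurable (Function.uncurry ℓ)) (hℓ : ∀ w z, ℓ w z ∈ Set.Icc (0 : ℝ) 1)
    (hmix : MixesAtRate prob Z ℓ φ) (hN : IsNorm N) (hα : 0 < α) (hreg : IsRegularizer N α h)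
    (hsep : HasSeparableDomain N h) {P₁ : ProbabilityMeasure W} (hP₁ : ∀ P, h P₁ ≤ h P)
    {B η : ℝ} (hB : 0 < B) (hη : 0 < η) {n d : ℕ} (hn : 1 ≤ n) (hd : 1 ≤ d) {D : ℝ} (hD : d ≤ D)
    {δ : ℝ} (hδ : 0 < δ) (hδ1 : δ ≤ 1) :
    ∃ T : Set Ω, prob T ≤ ENNReal.ofReal δ ∧ ∀ ω ∉ T,
      (∀ j < n, dualNorm N (cost ℓ (marginal prob Z) (Z (j + 1) ω)) ≤ (B : EReal)) →
      ∀ Q, h Q ≠ ⊤ →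
        η * -∑ j ∈ Finset.range n, expCost ℓ (marginal prob Z) (Z (j + 1) ω) Q
          ≤ D * ((h Q).toReal - (h P₁).toReal) + n * ((η * B) ^ 2 / (2 * α))
            + η * (n * φ d + n * Real.sqrt (2 * D * Real.log (1 / δ) / n)) := by
  set s : ℕ → ℝ := fun i => 1 / ((i : ℝ) + 1) / 2 with hs
  have hs0 : ∀ i, 0 < s i := fun i => by positivity
  have hs1 : ∀ i, s i < 1 := fun i => by
    have : 1 / ((i : ℝ) + 1) ≤ 1 := by
      rw [div_le_one (by positivity)]; linarith [(Nat.cast_nonneg i : (0 : ℝ) ≤ i)]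
    simp only [hs]; linarith
  have hslim : Filter.Tendsto s Filter.atTop (nhds 0) := by
    simpa [hs] using (tendsto_one_div_add_atTop_nhds_zero_nat (𝕜 := ℝ)).div_const 2
  choose T hT hTω using fun i => exists_event_gen_le hZ hℓ_meas hℓ hmix hN hα hreg hsep hP₁ hB hη
    hn hd hD hδ hδ1 (hs0 i) (hs1 i)
  have hmono : Monotone fun i => ⋂ j ≥ i, T j := fun i i' hii =>
    Set.biInter_mono (fun j (hj : i' ≤ j) => hii.trans hj) fun _ _ => le_rfl
  -- The limit inferior of the exceptional events is an increasing union of sets of measure at most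
  -- `δ`. Outside it the bound holds for infinitely many precisions, which suffices for the limit.
  refine ⟨⋃ i, ⋂ j ≥ i, T j, ?_, fun ω hω hcost Q hQ => ?_⟩
  · rw [hmono.measure_iUnion]
    exact iSup_le fun i => (measure_mono (Set.biInter_subset_of_mem (le_refl i))).trans (hT i)
  have hfreq : ∃ᶠ i in Filter.atTop, ω ∉ T i := by
    rw [Filter.frequently_atTop]
    intro i
    by_contra hcon
    push Not at hcon
    exact hω (Set.mem_iUnion.2 ⟨i, Set.mem_iInter₂.2 hcon⟩)
  refine ge_of_tendsto_of_frequently (f := fun i => D * ((h Q).toReal - (h P₁).toReal)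
      + n * ((η * B) ^ 2 / (2 * (α * (1 - s i))) + s i)
      + η * (n * φ d + n * Real.sqrt (2 * D * Real.log (1 / δ) / n))) ?_
    (hfreq.mono fun i hi => hTω i ω hi hcost Q hQ)
  refine Filter.Tendsto.add_const _ (Filter.Tendsto.const_add _ (Filter.Tendsto.const_mul _ ?_))
  have h1 : Filter.Tendsto (fun i => 2 * (α * (1 - s i))) Filter.atTop (nhds (2 * α)) := by
    simpa using ((hslim.const_sub 1).const_mul α).const_mul 2
  simpa using (tendsto_const_nhds (x := (η * B) ^ 2).div h1 (by positivity)).add hslim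

end Main

end OnlineToPAC

end

theorem mainTheorem6 {Ω 𝒵 W : Type*} [MeasurableSpace Ω] [MeasurableSpace 𝒵] [MeasurableSpace W]
    (prob : Measure Ω) [IsProbabilityMeasure prob] (Z : ℕ → Ω → 𝒵)
    -- the loss, with values in `[0, 1]`
    (ℓ : W → 𝒵 → ℝ) (hℓ_meas : Measurable (Function.uncurry ℓ))
    (hℓ : ∀ w z, ℓ w z ∈ Set.Icc (0 : ℝ) 1)
    {τ C : ℝ} (hmix : OnlineToPAC.IsGeometricallyMixing prob Z ℓ τ C)
    -- the norm on signed measures and the regularizer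
    (N : Seminorm ℝ (SignedMeasure W)) (hN : OnlineToPAC.IsNorm N)
    {α : ℝ} (hα : 0 < α) (h : ProbabilityMeasure W → EReal)
    (hreg : OnlineToPAC.IsRegularizer N α h) (hsep : OnlineToPAC.HasSeparableDomain N h)
    -- the initial prediction of follow-the-regularized-leader
    (P₁ : ProbabilityMeasure W) (hP₁ : ∀ P, h P₁ ≤ h P)
    {B : ℝ} (hB : 0 < B)
    (hcost : ∀ t : ℕ, 1 ≤ t → ∀ᵐ ω ∂prob,
      OnlineToPAC.dualNorm N
        (OnlineToPAC.cost ℓ (OnlineToPAC.marginal prob Z) (Z t ω)) ≤ (B : EReal))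
    {η : ℝ} (hη : 0 < η) (n : ℕ) (hn : 1 ≤ n) {δ : ℝ} (hδ : 0 < δ) :
    prob {ω | ¬ ∀ (𝒜 : ProbabilityTheory.Kernel (Fin n → 𝒵) W)
        [ProbabilityTheory.IsMarkovKernel 𝒜],
        (OnlineToPAC.gen ℓ (OnlineToPAC.marginal prob Z) 𝒜 (OnlineToPAC.sample Z n ω) : EReal)
          ≤ (h (OnlineToPAC.output 𝒜 (OnlineToPAC.sample Z n ω)) - h P₁)
              * (((τ * Real.log n + 1) / (η * n) : ℝ) : EReal)
            + ((η * B ^ 2 / (2 * α) + C / n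
              + Real.sqrt (2 * (τ * Real.log n + 1) * Real.log (1 / δ) / n) : ℝ) : EReal)}
      ≤ ENNReal.ofReal δ := by
  rcases lt_or_ge 1 δ with hδ1 | hδ1
  · exact prob_le_one.trans (by rw [← ENNReal.ofReal_one]; exact ENNReal.ofReal_le_ofReal hδ1.le)
  have hn0 : (0 : ℝ) < n := by exact_mod_cast hn
  have hτ := hmix.tau_pos
  have hlog : 0 ≤ τ * Real.log n :=
    mul_nonneg hτ.le (Real.log_nonneg (by exact_mod_cast hn))
  set D : ℝ := τ * Real.log n + 1 with hDdef
  have hD0 : 0 < D := by linarith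
  -- The ceiling of `τ log n`, raised to `1` because it vanishes for `n = 1`.
  obtain ⟨d, hd, hdD, hdn⟩ : ∃ d : ℕ, 1 ≤ d ∧ (d : ℝ) ≤ D ∧ τ * Real.log n ≤ d := by
    refine ⟨max 1 ⌈τ * Real.log n⌉₊, le_max_left _ _, ?_, ?_⟩
    · rw [Nat.cast_max, Nat.cast_one]
      exact max_le (by linarith) (Nat.ceil_lt_add_one hlog).le
    · exact (Nat.le_ceil _).trans (by exact_mod_cast le_max_right _ _)
  have hφ : C * Real.exp (-(d : ℝ) / τ) ≤ C / n := by
    rw [div_eq_mul_inv C]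
    refine mul_le_mul_of_nonneg_left ?_ hmix.C_pos.le
    rw [← Real.exp_log (inv_pos.2 hn0), Real.log_inv, Real.exp_le_exp, neg_div, neg_le_neg_iff,
      le_div_iff₀ hτ, mul_comm]
    exact hdn
  have := OnlineToPAC.isProbabilityMeasure_marginal (prob := prob) hmix.stationary.measurable
  obtain ⟨T, hT, hTω⟩ := OnlineToPAC.exists_event_gen_le_limit hmix.stationary.measurable hℓ_meas
    hℓ hmix.mixes hN hα hreg hsep hP₁ hB hη hn hd hdD hδ hδ1
  have hae : ∀ᵐ ω ∂prob, ∀ j : ℕ, OnlineToPAC.dualNorm N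
      (OnlineToPAC.cost ℓ (OnlineToPAC.marginal prob Z) (Z (j + 1) ω)) ≤ (B : EReal) :=
    ae_all_iff.2 fun j => hcost (j + 1) (by omega)
  refine le_trans (measure_mono_ae ?_) hT
  filter_upwards [hae] with ω hω hbad
  by_contra hωT
  refine hbad fun 𝒜 _ => ?_
  set Q := OnlineToPAC.output 𝒜 (OnlineToPAC.sample Z n ω) with hQdef
  have hP₁top : h P₁ ≠ ⊤ := by
    obtain ⟨P, hP⟩ := hreg.proper
    exact ne_top_of_le_ne_top hP (hP₁ P)
  have hcoef : 0 < D / (η * n) := by positivity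
  rw [← hreg.coe_toReal hP₁top]
  by_cases hQ : h Q = ⊤
  -- The coefficient is strictly positive, so an output outside the domain makes the right side `⊤`.
  · rw [hQ, EReal.top_sub_coe, EReal.top_mul_coe_of_pos hcoef, EReal.top_add_coe]
    exact le_top
  rw [← hreg.coe_toReal hQ, ← EReal.coe_sub, ← EReal.coe_mul, ← EReal.coe_add,
    EReal.coe_le_coe_iff, OnlineToPAC.gen_eq hℓ_meas hℓ Z hn, ← hQdef]
  have hmain := hTω ω hωT (fun j _ => hω j) Q hQ
  set S := -∑ j ∈ Finset.range n,
    OnlineToPAC.expCost ℓ (OnlineToPAC.marginal prob Z) (Z (j + 1) ω) Q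
  set r := Real.sqrt (2 * D * Real.log (1 / δ) / n)
  refine le_of_mul_le_mul_left (a := η * n) ?_ (by positivity)
  have h1 : η * n * (1 / (n : ℝ) * S) = η * S := by field_simp
  have h2 : η * n * (((h Q).toReal - (h P₁).toReal) * (D / (η * n))
      + (η * B ^ 2 / (2 * α) + C / n + r))
      = D * ((h Q).toReal - (h P₁).toReal) + n * ((η * B) ^ 2 / (2 * α))
        + η * (n * (C / n) + n * r) := by
    field_simp
    ring
  rw [h1, h2]
  refine hmain.trans (add_le_add_right (mul_le_mul_of_nonneg_left ?_ hη.le) _)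
  exact add_le_add_left (mul_le_mul_of_nonneg_left hφ hn0.le) _
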